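/- Let $E$ be a finite set of items and $O$ a finite set of states. The states $Y_e$ $(e\in E)$ are independent, $Y_e$ having a known distribution $\mathcal D_e$ on $O$. Let $\mathcal I$ be a downward-closed family of subsets of $E$, let $\varepsilon\in(0,1]$, and let $\mathcal F=\{f_1,\dots,f_m\}$, $m\ge 1$, be reward functions $f_i:2^{E\times O}\to\mathbb R_{\ge 0}$, each monotone and $\varepsilon$-nearly submodular, i.e. for each $i$ there is a submodular $g_i:2^{E\times O}\to\mathbb R_{\ge0}$ with $\varepsilon g_i(X)\le f_i(X)\le \frac1\varepsilon g_i(X)$ for all $X\subseteq E\times O$. An adaptive policy $\pi$ maps the set of item-state pairs observed so far to the next item to pick, or stops; the state of an item is observed when the item is picked. Let $S(\pi,y)\subseteq E\times O$ and $E(\pi,y)\subseteq E$ be the sets of item-state pairs and of items that it picks when the states are $y\in O^E$. The policy is feasible if $E(\pi,y)\in\mathcal I$ for every $y$; its utility is $\mathcal U(\pi,\mathcal F)=\min_{i\in[m]}\mathbb E_{Y}[f_i(S(\pi,Y))]$. ARONSS is the problem of maximizing $\mathcal U(\pi,\mathcal F)$ over the feasible policies. For $S\subseteq E$ put $\mathcal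 U(S,f_i)=\mathbb E_{Y}[f_i(\{(e,Y_e):e\in S\})]$. A non-adaptive policy $\sigma$ is a probability distribution $(x_S)_{S\in\mathcal I}$ on $\mathcal I$, with utility $\mathcal U(\sigma,\mathcal F)=\min_{i\in[m]}\sum_{S\in\mathcal I}x_S\,\mathcal U(S,f_i)$; problem P.2 is to maximize this utility over all such distributions. Let $\sigma^{\mathrm{DO}}$ (the output of the double-oracle algorithm) be a $\beta$-approximate solution of P.2, i.e. a distribution on $\mathcal I$ with $\mathcal U(\sigma^{\mathrm{DO}},\mathcal F)\ge\beta\,\mathcal U(\sigma,\mathcal F)$ for every distribution $\sigma$ on $\mathcal I$. Then an optimal feasible adaptive policy $\pi^*$ exists, and every such policy satisfies $$\mathcal U(\sigma^{\mathrm{DO}},\mathcal F)\ \ge\ \frac{\varepsilon^2\beta}{2}\,\mathcal U(\pi^*,\mathcal F).$$ The same bound holds with $\pi^*$ replaced by any randomized feasible adaptive policy, that is, any probability distribution $q$ on feasible adaptive policies, with utility $\min_{i\in[m]}\sum_{\pi}q_\pi\,\mathbb E_Y[f_i(S(\pi,Y))]$. -/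

import Mathlib

open scoped BigOperators

namespace ARONSS

/-- Submodularity of a set function on a finite ground set, through diminishing marginal returns. -/
def IsSubmodular {Ω : Type*} [DecidableEq Ω] (h : Finset Ω → ℝ) : Prop :=
  ∀ S₁ S₂ : Finset Ω, S₁ ⊆ S₂ → ∀ v : Ω, v ∉ S₂ →
    h (insert v S₂) - h S₂ ≤ h (insert v S₁) - h S₁

/-- `f` is `ε`-nearly submodular: it is sandwiched between `ε • g` and `(1 / ε) • g` for some
nonnegative submodular function `g` (which is not required to be monotone). -/
def IsNearlySubmodular {Ω : Type*} [DecidableEq Ω] (ε : ℝ) (f : Finset Ω → ℝ) : Prop :=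
  ∃ g : Finset Ω → ℝ, (∀ X, 0 ≤ g X) ∧ IsSubmodular g ∧
    ∀ X, ε * g X ≤ f X ∧ f X ≤ 1 / ε * g X

/-- A (deterministic) adaptive policy: given the set of item-state pairs observed so far,
it names the next item to pick, or stops (`none`). -/
abbrev Policy (E O : Type*) : Type _ := Finset (E × O) → Option E

section
variable {E O : Type*} [Fintype E] [DecidableEq E] [Fintype O] [DecidableEq O] {m : ℕ}

/-- Expectation of `F` when the state vector `y` is drawn from the product distribution
of the `D e`. -/
noncomputable def expect (D : E → O → ℝ) (F : (E → O) → ℝ) : ℝ :=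
  ∑ y : E → O, (∏ e, D e (y e)) * F y

/-- The observations made by the policy `π` in the first `k` rounds when the items are in
state `y`. Naming an item that was already picked changes nothing, now or in later rounds. -/
def Policy.run (π : Policy E O) (y : E → O) : ℕ → Finset (E × O)
  | 0 => ∅
  | k + 1 =>
    match π (Policy.run π y k) with
    | none => Policy.run π y k
    | some e => insert (e, y e) (Policy.run π y k)

/-- The item-state pairs `S(π, y)` picked by `π` when the items are in state `y`.
No new item can be picked after `|E|` rounds. -/
def Policy.picked (π : Policy E O) (y : E → O) : Finset (E × O) :=
  π.run y (Fintype.card E)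

/-- The items `E(π, y)` picked by `π` when the items are in state `y`. -/
def Policy.items (π : Policy E O) (y : E → O) : Finset E :=
  (π.picked y).image Prod.fst

/-- A policy is feasible if, whatever the states, the picked set of items belongs to `I`. -/
def Policy.IsFeasible (I : Finset (Finset E)) (π : Policy E O) : Prop :=
  ∀ y : E → O, π.items y ∈ I

/-- Expected reward `U(π, f)` of a policy for one reward function. -/
noncomputable def Policy.reward (D : E → O → ℝ) (f : Finset (E × O) → ℝ)
    (π : Policy E O) : ℝ :=
  expect D fun y => f (π.picked y)

/-- Worst-case utility `U(π, F) = min_i U(π, f_i)`. -/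
noncomputable def Policy.utility (D : E → O → ℝ) (f : Fin m → Finset (E × O) → ℝ)
    (π : Policy E O) : ℝ :=
  ⨅ i, π.reward D (f i)

/-- An optimal adaptive policy: it is feasible and maximizes the worst-case utility among the
feasible policies. -/
def Policy.IsOptimal (D : E → O → ℝ) (f : Fin m → Finset (E × O) → ℝ)
    (I : Finset (Finset E)) (π : Policy E O) : Prop :=
  π.IsFeasible I ∧ ∀ π' : Policy E O, π'.IsFeasible I → π'.utility D f ≤ π.utility D f

/-- `q` is a feasible randomized adaptive policy: a probability distribution over deterministic
policies that gives positive weight to feasible ones only. -/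
def IsFeasibleRandomized (I : Finset (Finset E)) (q : Policy E O → ℝ) : Prop :=
  q ∈ stdSimplex ℝ (Policy E O) ∧ ∀ π : Policy E O, q π ≠ 0 → π.IsFeasible I

/-- Worst-case utility of a randomized adaptive policy. -/
noncomputable def randomizedUtility (D : E → O → ℝ) (f : Fin m → Finset (E × O) → ℝ)
    (q : Policy E O → ℝ) : ℝ :=
  ⨅ i, ∑ π : Policy E O, q π * π.reward D (f i)

/-- `U(S, f)`: the expected value of `f` obtained from picking the items of `S`,
irrespective of the states. -/
noncomputable def setReward (D : E → O → ℝ) (f : Finset (E × O) → ℝ) (S : Finset E) : ℝ :=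
  expect D fun y => f (S.image fun e => (e, y e))

/-- The feasible points of the program over distributions on `I`: `x S` is the probability of
picking `S`, so that `x` is a (randomized) non-adaptive policy. -/
def IsNonadaptive (I : Finset (Finset E)) (x : Finset E → ℝ) : Prop :=
  ∑ S ∈ I, x S = 1 ∧ ∀ S ∈ I, 0 ≤ x S

/-- The objective of that program, which is the worst-case utility of the non-adaptive
policy `x`. -/
noncomputable def nonadaptiveUtility (D : E → O → ℝ) (f : Fin m → Finset (E × O) → ℝ)
    (I : Finset (Finset E)) (x : Finset E → ℝ) : ℝ :=
  ⨅ i, ∑ S ∈ I, x S * setReward D (f i) S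

/-- `x` is a `β`-approximate solution of that program. -/
def IsApproxSolution (D : E → O → ℝ) (f : Fin m → Finset (E × O) → ℝ)
    (I : Finset (Finset E)) (β : ℝ) (x : Finset E → ℝ) : Prop :=
  IsNonadaptive I x ∧ ∀ x' : Finset E → ℝ, IsNonadaptive I x' →
    β * nonadaptiveUtility D f I x' ≤ nonadaptiveUtility D f I x

end

end ARONSS

/-! Two reductions carry the bound. Since `f` is monotone, `g` can be replaced by its largest
monotone minorant, which is still submodular and still within `ε` of `f`
(`IsNearlySubmodular.exists_monotone`). For monotone submodular `h` the adaptivity gap is at most 2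
(`Policy.reward_le_two_mul`). Run `π` in states `y` and pick the same items in independent states
`z` (the ghost). The gain of each round on top of the final ghost is at most the gain of the
observed pair on the current ghost. Swapping the new item's states in `y` and `z` preserves their
law and makes this a ghost increment, so the gains telescope to one more ghost value. The law of the
ghost's item set does not depend on `i`, so it is one non-adaptive policy good for all `f i`,
against which `β` compares `σ`. -/

namespace ARONSS

/-! ### Monotone submodular minorants -/

section Submodular

variable {Ω : Type*} [DecidableEq Ω]

/-- Add the elements of `B \ A` one at a time, to `A` and to `A ∩ B`, and compare marginals. -/
lemma IsSubmodular.union_add_inter_le {g : Finset Ω → ℝ} (hg : IsSubmodular g) (A B : Finset Ω) :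
    g (A ∪ B) + g (A ∩ B) ≤ g A + g B := by
  have key : ∀ T : Finset Ω, Disjoint T A →
      g (A ∪ T) - g A ≤ g ((A ∩ B) ∪ T) - g (A ∩ B) := by
    intro T
    induction T using Finset.induction_on with
    | empty => intro _; simp
    | insert v T hv ih =>
      intro hd
      rw [Finset.disjoint_insert_left] at hd
      have h := hg ((A ∩ B) ∪ T) (A ∪ T)
        (Finset.union_subset_union Finset.inter_subset_left subset_rfl) v (by simp [hv, hd.1])
      have h' := ih hd.2
      rw [Finset.union_insert, Finset.union_insert]
      linarith
  have h := key (B \ A) Finset.sdiff_disjoint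
  have h1 : A ∪ B \ A = A ∪ B := by simp
  have h2 : A ∩ B ∪ B \ A = B := by
    ext x
    simp only [Finset.mem_union, Finset.mem_inter, Finset.mem_sdiff]; tauto
  rw [h1, h2] at h
  linarith

/-- The witness is `h X = min {g Z | X ⊆ Z}`. That the minimum is attained at some `Z ⊇ X` later
transfers lower bounds from `g` to `h`. -/
lemma IsSubmodular.exists_monotone_minorant [Fintype Ω] {g : Finset Ω → ℝ}
    (hg : IsSubmodular g) :
    ∃ h : Finset Ω → ℝ, Monotone h ∧ IsSubmodular h ∧ (∀ X, ∃ Z, X ⊆ Z ∧ h X = g Z) ∧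
      ∀ X, h X ≤ g X := by
  have hmin : ∀ X : Finset Ω, ∃ Z, X ⊆ Z ∧ ∀ W, X ⊆ W → g Z ≤ g W := by
    intro X
    obtain ⟨Z, hZ, hle⟩ := Finset.exists_min_image (Finset.univ.filter (X ⊆ ·)) g
      ⟨X, by simp⟩
    exact ⟨Z, by simpa using hZ, fun W hW => hle W (by simpa using hW)⟩
  choose m hm hle using hmin
  refine ⟨fun X => g (m X), fun X Y hXY => hle X _ (hXY.trans (hm Y)), ?_,
    fun X => ⟨m X, hm X, rfl⟩, fun X => hle X X subset_rfl⟩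
  intro S₁ S₂ hS v _
  -- The union of these two minimizers competes for `insert v S₂`, their intersection for `S₁`.
  have h := hg.union_add_inter_le (m (insert v S₁)) (m S₂)
  have h1 := hle (insert v S₂) (m (insert v S₁) ∪ m S₂) (Finset.insert_subset
    (Finset.mem_union_left _ (hm _ (Finset.mem_insert_self v S₁)))
    ((hm S₂).trans Finset.subset_union_right))
  have h2 := hle S₁ (m (insert v S₁) ∩ m S₂) (Finset.subset_inter
    ((Finset.subset_insert v S₁).trans (hm _)) (hS.trans (hm S₂)))
  dsimp only
  linarith

lemma IsNearlySubmodular.exists_monotone [Fintype Ω] {ε : ℝ} (hε : 0 < ε)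
    {f : Finset Ω → ℝ} (hf : Monotone f) (hn : IsNearlySubmodular ε f) :
    ∃ h : Finset Ω → ℝ, (∀ X, 0 ≤ h X) ∧ Monotone h ∧ IsSubmodular h ∧
      (∀ X, ε * h X ≤ f X) ∧ ∀ X, ε * f X ≤ h X := by
  obtain ⟨g, hg0, hg, hfg⟩ := hn
  obtain ⟨h, hmono, hsub, hatt, hle⟩ := hg.exists_monotone_minorant
  refine ⟨h, fun X => ?_, hmono, hsub,
    fun X => (mul_le_mul_of_nonneg_left (hle X) hε.le).trans (hfg X).1, fun X => ?_⟩
  · obtain ⟨Z, -, hZ⟩ := hatt X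
    exact hZ ▸ hg0 Z
  · obtain ⟨Z, hXZ, hZ⟩ := hatt X
    have h1 := (hf hXZ).trans (hfg Z).2
    rw [one_div, inv_mul_eq_div, le_div_iff₀ hε] at h1
    rw [hZ]
    linarith

lemma IsSubmodular.marginal_le {h : Finset Ω → ℝ} (hs : IsSubmodular h) (hm : Monotone h)
    {S₁ S₂ : Finset Ω} (hS : S₁ ⊆ S₂) (v : Ω) :
    h (insert v S₂) - h S₂ ≤ h (insert v S₁) - h S₁ := by
  by_cases hv : v ∈ S₂
  · rw [Finset.insert_eq_of_mem hv, sub_self, sub_nonneg]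
    exact hm (Finset.subset_insert v S₁)
  · exact hs S₁ S₂ hS v hv

end Submodular

/-! ### Expectation over product distributions -/

section Expectation

lemma prod_states_nonneg {E O : Type*} [Fintype E] [Fintype O] {D : E → O → ℝ}
    (hD : ∀ e, D e ∈ stdSimplex ℝ O) (y : E → O) :
    0 ≤ ∏ e, D e (y e) :=
  Finset.prod_nonneg fun e _ => (hD e).1 _

variable {E O : Type*} [Fintype E] [DecidableEq E] [Fintype O]

lemma sum_prod_eq_one {D : E → O → ℝ} (hD : ∀ e, D e ∈ stdSimplex ℝ O) :
    ∑ y : E → O, ∏ e, D e (y e) = 1 := by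
  rw [← Fintype.prod_sum]
  exact Finset.prod_eq_one fun e _ => (hD e).2

lemma expect_const {D : E → O → ℝ} (hD : ∀ e, D e ∈ stdSimplex ℝ O) (c : ℝ) :
    (expect D fun _ => c) = c := by
  rw [expect, ← Finset.sum_mul, sum_prod_eq_one hD, one_mul]

lemma expect_mono {D : E → O → ℝ} (hD : ∀ e, D e ∈ stdSimplex ℝ O) {F G : (E → O) → ℝ}
    (h : ∀ y, F y ≤ G y) : expect D F ≤ expect D G :=
  Finset.sum_le_sum fun y _ => mul_le_mul_of_nonneg_left (h y) (prod_states_nonneg hD y)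

lemma expect_nonneg {D : E → O → ℝ} (hD : ∀ e, D e ∈ stdSimplex ℝ O) {F : (E → O) → ℝ}
    (h : ∀ y, 0 ≤ F y) : 0 ≤ expect D F :=
  Finset.sum_nonneg fun y _ => mul_nonneg (prod_states_nonneg hD y) (h y)

lemma expect_add (D : E → O → ℝ) (F G : (E → O) → ℝ) :
    (expect D fun y => F y + G y) = expect D F + expect D G := by
  simp only [expect, mul_add, Finset.sum_add_distrib]

lemma expect_sub (D : E → O → ℝ) (F G : (E → O) → ℝ) :
    (expect D fun y => F y - G y) = expect D F - expect D G := by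
  simp only [expect, mul_sub, Finset.sum_sub_distrib]

lemma expect_const_mul (D : E → O → ℝ) (c : ℝ) (F : (E → O) → ℝ) :
    (expect D fun y => c * F y) = c * expect D F := by
  simp only [expect, Finset.mul_sum, mul_left_comm c]

lemma expect_sum {ι : Type*} (D : E → O → ℝ) (s : Finset ι) (F : ι → (E → O) → ℝ) :
    (expect D fun y => ∑ k ∈ s, F k y) = ∑ k ∈ s, expect D (F k) := by
  simp only [expect, Finset.mul_sum]
  exact Finset.sum_comm

lemma expect_expect (D : E → O → ℝ) (F : (E → O) → (E → O) → ℝ) :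
    (expect D fun y => expect D (F y)) =
      ∑ p : (E → O) × (E → O), ((∏ e, D e (p.1 e)) * ∏ e, D e (p.2 e)) * F p.1 p.2 := by
  rw [Fintype.sum_prod_type]
  simp only [expect, Finset.mul_sum, mul_assoc]

end Expectation

/-! ### Policy runs and the exchange argument -/

section Policies

variable {E O : Type*} [DecidableEq E] [DecidableEq O]

lemma Policy.run_eq_image (π : Policy E O) (y : E → O) (k : ℕ) :
    π.run y k = ((π.run y k).image Prod.fst).image fun e => (e, y e) := by
  induction k with
  | zero => simp [Policy.run]
  | succ k ih =>
    rw [Policy.run]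
    split
    · exact ih
    · rw [Finset.image_insert, Finset.image_insert, ← ih]

/-- A policy reads only the states of the items it picks. -/
lemma Policy.run_congr (π : Policy E O) {y y' : E → O} (k : ℕ)
    (h : ∀ e ∈ (π.run y k).image Prod.fst, y' e = y e) : π.run y' k = π.run y k := by
  induction k with
  | zero => rfl
  | succ k ih =>
    rw [Policy.run] at h ⊢
    rw [Policy.run]
    cases hp : π (π.run y k) with
    | none =>
      rw [hp] at h
      simp only [ih h, hp]
    | some e =>
      rw [hp] at h
      simp only [Finset.image_insert, Finset.mem_insert] at h
      simp only [ih fun e he => h e (Or.inr he), hp, h e (Or.inl rfl)]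

/-- The pairs that would be observed in states `z` on picking the items that `π` picks in its
first `k` rounds in states `y`. -/
def Policy.ghost (π : Policy E O) (y z : E → O) (k : ℕ) : Finset (E × O) :=
  ((π.run y k).image Prod.fst).image fun e => (e, z e)

/-- Exchange of the states in `y` and `z` of the item newly picked by `π` in round `k`,
if there is one. -/
def Policy.exchange (π : Policy E O) (k : ℕ) (p : (E → O) × (E → O)) : (E → O) × (E → O) :=
  match π (π.run p.1 k) with
  | none => p
  | some e =>
    if e ∈ (π.run p.1 k).image Prod.fst then p
    else (Function.update p.1 e (p.2 e), Function.update p.2 e (p.1 e))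

lemma Policy.run_exchange (π : Policy E O) (k : ℕ) (p : (E → O) × (E → O)) :
    π.run (π.exchange k p).1 k = π.run p.1 k := by
  apply Policy.run_congr
  intro e he
  unfold Policy.exchange
  split
  · rfl
  · split_ifs with h
    · rfl
    · exact Function.update_of_ne (fun h' => h (by rwa [← h'])) _ _

lemma Policy.exchange_involutive (π : Policy E O) (k : ℕ) :
    Function.Involutive (π.exchange k) := by
  intro p
  have hrun := π.run_exchange k p
  cases hp : π (π.run p.1 k) with
  | none =>
    have h : π.exchange k p = p := by simp only [Policy.exchange, hp]
    rw [h, h]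
  | some e =>
    by_cases he : e ∈ (π.run p.1 k).image Prod.fst
    · have h : π.exchange k p = p := by simp only [Policy.exchange, hp, if_pos he]
      rw [h, h]
    · have h : π.exchange k p =
          (Function.update p.1 e (p.2 e), Function.update p.2 e (p.1 e)) := by
        simp only [Policy.exchange, hp, if_neg he]
      rw [Policy.exchange, hrun, hp]
      dsimp only
      rw [if_neg he, h]
      simp

lemma Policy.ghost_subset_succ (π : Policy E O) (y z : E → O) (k : ℕ) :
    π.ghost y z k ⊆ π.ghost y z (k + 1) := by
  unfold Policy.ghost
  refine Finset.image_subset_image (Finset.image_subset_image ?_)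
  rw [Policy.run]
  split
  · rfl
  · exact Finset.subset_insert _ _

/-- The exchange leaves the first `k` rounds unchanged, so `e` is still picked next, but the ghost
now sees it in state `y e`. -/
lemma Policy.ghost_exchange_succ (π : Policy E O) (k : ℕ) (y z : E → O) {e : E}
    (hp : π (π.run y k) = some e) (he : e ∉ (π.run y k).image Prod.fst) :
    π.ghost (π.exchange k (y, z)).1 (π.exchange k (y, z)).2 (k + 1) =
      insert (e, y e) (π.ghost y z k) := by
  have hrun := π.run_exchange k (y, z)
  have h : π.exchange k (y, z) = (Function.update y e (z e), Function.update z e (y e)) := by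
    simp only [Policy.exchange, hp, if_neg he]
  rw [Policy.ghost, Policy.run, hrun, hp]
  simp only [Finset.image_insert, h, Function.update_self]
  congr 1
  refine Finset.image_congr fun e' he' => ?_
  have hne : e' ≠ e := fun h' => he (h' ▸ he')
  simp [hne]

/-- Every round adds to the value of the adaptive run, on top of a set containing the ghost
observations, at most the marginal value of a ghost observation with exchanged states. -/
lemma Policy.run_step_le {h : Finset (E × O) → ℝ} (hm : Monotone h) (hs : IsSubmodular h)
    (π : Policy E O) (y z : E → O) (k : ℕ) {N : Finset (E × O)} (hN : π.ghost y z k ⊆ N) :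
    h (π.run y (k + 1) ∪ N) - h (π.run y k ∪ N) ≤
      h (π.ghost (π.exchange k (y, z)).1 (π.exchange k (y, z)).2 (k + 1)) -
        h (π.ghost y z k) := by
  have hid : π.exchange k (y, z) = (y, z) →
      h (π.ghost y z k) ≤
        h (π.ghost (π.exchange k (y, z)).1 (π.exchange k (y, z)).2 (k + 1)) := by
    intro hx
    rw [hx]
    exact hm (π.ghost_subset_succ y z k)
  rw [Policy.run]
  cases hp : π (π.run y k) with
  | none =>
    have := hid (by simp only [Policy.exchange, hp])
    simpa using this
  | some e =>
    by_cases he : e ∈ (π.run y k).image Prod.fst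
    · have h1 := hid (by simp only [Policy.exchange, hp, if_pos he])
      have h2 : (e, y e) ∈ π.run y k := by
        rw [π.run_eq_image y k]
        exact Finset.mem_image_of_mem (fun e => (e, y e)) he
      simpa [Finset.insert_eq_of_mem h2] using h1
    · rw [π.ghost_exchange_succ k y z hp he]
      dsimp only
      rw [Finset.insert_union]
      exact hs.marginal_le hm (hN.trans Finset.subset_union_right) _

lemma Policy.ghost_mono (π : Policy E O) (y z : E → O) : Monotone (π.ghost y z) :=
  monotone_nat_of_le_succ (π.ghost_subset_succ y z)

lemma Policy.run_le_ghost_add_sum {h : Finset (E × O) → ℝ} (hm : Monotone h)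
    (hs : IsSubmodular h) (π : Policy E O) (y z : E → O) (n : ℕ) :
    h (π.run y n) ≤ h (π.ghost y z n) + ∑ k ∈ Finset.range n,
      (h (π.ghost (π.exchange k (y, z)).1 (π.exchange k (y, z)).2 (k + 1)) -
        h (π.ghost y z k)) := by
  -- Taking the final ghost as `N` in every round makes the left side telescope.
  have h1 := Finset.sum_le_sum (s := Finset.range n) fun k hk => π.run_step_le hm hs y z k
    (π.ghost_mono y z (Finset.mem_range.1 hk).le)
  rw [Finset.sum_range_sub fun k => h (π.run y k ∪ π.ghost y z n)] at h1
  have h2 : h (π.run y n) ≤ h (π.run y n ∪ π.ghost y z n) := hm Finset.subset_union_left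
  rw [Policy.run, Finset.empty_union] at h1
  linarith

lemma Policy.run_stop (y : E → O) (k : ℕ) : Policy.run (fun _ => none) y k = ∅ := by
  induction k with
  | zero => rfl
  | succ k ih => rw [Policy.run]; exact ih

/-- Both swapped states belong to the same item, hence have the same law `D e`. -/
lemma Policy.prod_exchange [Fintype E] (D : E → O → ℝ) (π : Policy E O) (k : ℕ)
    (p : (E → O) × (E → O)) :
    (∏ e, D e ((π.exchange k p).1 e)) * ∏ e, D e ((π.exchange k p).2 e) =
      (∏ e, D e (p.1 e)) * ∏ e, D e (p.2 e) := by
  rw [← Finset.prod_mul_distrib, ← Finset.prod_mul_distrib]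
  refine Finset.prod_congr rfl fun e _ => ?_
  unfold Policy.exchange
  split
  · rfl
  · rename_i e' _
    split_ifs
    · rfl
    · by_cases hee : e = e'
      · subst hee
        simp [mul_comm]
      · simp [hee]

variable [Fintype E] [Fintype O]

lemma Policy.expect_exchange (D : E → O → ℝ) (π : Policy E O) (k : ℕ)
    (F : (E → O) → (E → O) → ℝ) :
    (expect D fun y => expect D fun z => F (π.exchange k (y, z)).1 (π.exchange k (y, z)).2) =
      expect D fun y => expect D (F y) := by
  rw [expect_expect, expect_expect]
  refine Fintype.sum_bijective _ (π.exchange_involutive k).bijective _ _ fun p => ?_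
  rw [π.prod_exchange]

/-- The adaptivity gap of a monotone nonnegative submodular function is at most `2`: picking the
items of an independent simulation of `π` loses at most half of the value of `π`. -/
lemma Policy.reward_le_two_mul {D : E → O → ℝ} (hD : ∀ e, D e ∈ stdSimplex ℝ O)
    {h : Finset (E × O) → ℝ} (h0 : ∀ X, 0 ≤ h X) (hm : Monotone h) (hs : IsSubmodular h)
    (π : Policy E O) :
    π.reward D h ≤ 2 * expect D fun y => setReward D h (π.items y) := by
  set n := Fintype.card E
  set G : ℕ → ℝ := fun k => expect D fun y => expect D fun z => h (π.ghost y z k)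
  have h1 : π.reward D h ≤ expect D fun y => expect D fun z =>
      h (π.ghost y z n) + ∑ k ∈ Finset.range n,
        (h (π.ghost (π.exchange k (y, z)).1 (π.exchange k (y, z)).2 (k + 1)) -
          h (π.ghost y z k)) := by
    refine expect_mono hD fun y => ?_
    rw [← expect_const hD (h (π.picked y))]
    exact expect_mono hD fun z => π.run_le_ghost_add_sum hm hs y z n
  simp only [expect_add, expect_sum, expect_sub] at h1
  have hx (k : ℕ) := π.expect_exchange D k fun y z => h (π.ghost y z (k + 1))
  simp only [hx] at h1
  have h2 := Finset.sum_range_sub G n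
  have h3 : 0 ≤ G 0 := expect_nonneg hD fun y => expect_nonneg hD fun z => h0 _
  have h4 : (expect D fun y => setReward D h (π.items y)) = G n := rfl
  rw [h4]
  change _ ≤ G n + ∑ k ∈ Finset.range n, (G (k + 1) - G k) at h1
  linarith

lemma Policy.reward_le_of_isNearlySubmodular {D : E → O → ℝ}
    (hD : ∀ e, D e ∈ stdSimplex ℝ O) {ε : ℝ} (hε : 0 < ε) {f : Finset (E × O) → ℝ}
    (hf : Monotone f) (hn : IsNearlySubmodular ε f) (π : Policy E O) :
    ε ^ 2 / 2 * π.reward D f ≤ expect D fun y => setReward D f (π.items y) := by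
  obtain ⟨h, h0, hm, hs, hl, hu⟩ := hn.exists_monotone hε hf
  have h1 : ε * π.reward D f ≤ π.reward D h := by
    rw [Policy.reward, ← expect_const_mul]
    exact expect_mono hD fun y => hu _
  have h2 := π.reward_le_two_mul hD h0 hm hs
  have h3 : ε * (expect D fun y => setReward D h (π.items y)) ≤
      expect D fun y => setReward D f (π.items y) := by
    rw [← expect_const_mul]
    refine expect_mono hD fun y => ?_
    rw [setReward, ← expect_const_mul]
    exact expect_mono hD fun z => hl _
  have h4 := mul_le_mul_of_nonneg_left (h1.trans h2) hε.le
  linarith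

/-! ### Simulation by a non-adaptive policy -/

/-- The law of the set of items picked by an independent simulation of the randomized
policy `q`. -/
noncomputable def simulation (D : E → O → ℝ) (q : Policy E O → ℝ) (S : Finset E) : ℝ :=
  ∑ π : Policy E O, q π * expect D fun y => if π.items y = S then 1 else 0

/-- Feasibility puts `π.items y` in `I` whenever `q π ≠ 0`, so summing over `I` loses no mass. -/
lemma sum_simulation_mul (D : E → O → ℝ) {I : Finset (Finset E)} {q : Policy E O → ℝ}
    (hq : IsFeasibleRandomized I q) (u : Finset E → ℝ) :
    ∑ S ∈ I, simulation D q S * u S =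
      ∑ π : Policy E O, q π * expect D fun y => u (π.items y) := by
  simp only [simulation, Finset.sum_mul]
  rw [Finset.sum_comm]
  refine Finset.sum_congr rfl fun π _ => ?_
  by_cases hπ : q π = 0
  · simp [hπ]
  · have hfe := hq.2 π hπ
    simp only [mul_assoc]
    rw [← Finset.mul_sum]
    congr 1
    simp only [mul_comm _ (u _), ← expect_const_mul]
    rw [← expect_sum]
    congr 1
    funext y
    simp [hfe y]

lemma isNonadaptive_simulation {D : E → O → ℝ} (hD : ∀ e, D e ∈ stdSimplex ℝ O)
    {I : Finset (Finset E)} {q : Policy E O → ℝ} (hq : IsFeasibleRandomized I q) :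
    IsNonadaptive I (simulation D q) := by
  refine ⟨?_, fun S _ => Finset.sum_nonneg fun π _ => mul_nonneg (hq.1.1 π)
    (expect_nonneg hD fun y => by split_ifs <;> norm_num)⟩
  have h := sum_simulation_mul D hq fun _ => 1
  simpa only [mul_one, expect_const hD, hq.1.2] using h

variable {m : ℕ}

lemma randomizedUtility_le_simulation (hm : 0 < m) {D : E → O → ℝ}
    (hD : ∀ e, D e ∈ stdSimplex ℝ O) {I : Finset (Finset E)} {ε : ℝ} (hε : 0 < ε)
    {f : Fin m → Finset (E × O) → ℝ} (hf : ∀ i, Monotone (f i))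
    (hn : ∀ i, IsNearlySubmodular ε (f i)) {q : Policy E O → ℝ}
    (hq : IsFeasibleRandomized I q) :
    ε ^ 2 / 2 * randomizedUtility D f q ≤ nonadaptiveUtility D f I (simulation D q) := by
  have : Nonempty (Fin m) := ⟨⟨0, hm⟩⟩
  refine le_ciInf fun i => ?_
  rw [sum_simulation_mul D hq]
  refine (mul_le_mul_of_nonneg_left (ciInf_le (Set.finite_range _).bddBelow i)
    (by positivity)).trans ?_
  rw [Finset.mul_sum]
  refine Finset.sum_le_sum fun π _ => ?_
  rw [mul_left_comm]
  exact mul_le_mul_of_nonneg_left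
    (π.reward_le_of_isNearlySubmodular hD hε (hf i) (hn i)) (hq.1.1 π)

lemma randomizedUtility_single (D : E → O → ℝ) (f : Fin m → Finset (E × O) → ℝ)
    (π : Policy E O) : randomizedUtility D f (Pi.single π 1) = π.utility D f := by
  simp [randomizedUtility, Policy.utility, Pi.single_apply]

lemma Policy.IsFeasible.isFeasibleRandomized_single {I : Finset (Finset E)} {π : Policy E O}
    (hπ : π.IsFeasible I) : IsFeasibleRandomized I (Pi.single π 1) := by
  refine ⟨single_mem_stdSimplex ℝ π, fun π' h => ?_⟩
  by_cases hp : π' = π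
  · exact hp ▸ hπ
  · simp [hp] at h

lemma Policy.exists_isOptimal (D : E → O → ℝ) (f : Fin m → Finset (E × O) → ℝ)
    {I : Finset (Finset E)} (hI : ∅ ∈ I) : ∃ π : Policy E O, π.IsOptimal D f I := by
  classical
  obtain ⟨π, hπ, hmax⟩ := Finset.exists_max_image
    (Finset.univ.filter fun π : Policy E O => π.IsFeasible I) (fun π => π.utility D f)
    ⟨fun _ => none, by
      simp only [Finset.mem_filter, Finset.mem_univ, true_and]
      intro y
      rwa [Policy.items, Policy.picked, Policy.run_stop, Finset.image_empty]⟩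
  exact ⟨π, by simpa using hπ, fun π' hπ' => hmax π' (by simpa using hπ')⟩

end Policies

end ARONSS

theorem theorem3 {E O : Type*} [Fintype E] [DecidableEq E] [Fintype O] [DecidableEq O]
    (m : ℕ) (hm : 0 < m)
    (D : E → O → ℝ) (hD : ∀ e, D e ∈ stdSimplex ℝ O)
    (I : Finset (Finset E)) (hI : ∀ S ∈ I, ∀ T, T ⊆ S → T ∈ I)
    (ε : ℝ) (hε₀ : 0 < ε) (hε₁ : ε ≤ 1)
    (f : Fin m → Finset (E × O) → ℝ)
    (hf_nonneg : ∀ i X, 0 ≤ f i X)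
    (hf_mono : ∀ i, Monotone (f i))
    (hf_near : ∀ i, ARONSS.IsNearlySubmodular ε (f i))
    (β : ℝ) (σ : Finset E → ℝ) (hσ : ARONSS.IsApproxSolution D f I β σ) :
    (∃ π : ARONSS.Policy E O, π.IsOptimal D f I) ∧
    (∀ π : ARONSS.Policy E O, π.IsOptimal D f I →
      ε ^ 2 * β / 2 * π.utility D f ≤ ARONSS.nonadaptiveUtility D f I σ) ∧
    (∀ q : ARONSS.Policy E O → ℝ, ARONSS.IsFeasibleRandomized I q →
      ε ^ 2 * β / 2 * ARONSS.randomizedUtility D f q ≤ ARONSS.nonadaptiveUtility D f I σ) := by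
  have hσ0 : 0 ≤ ARONSS.nonadaptiveUtility D f I σ :=
    Real.iInf_nonneg fun i => Finset.sum_nonneg fun S hS => mul_nonneg (hσ.1.2 S hS)
      (ARONSS.expect_nonneg hD fun y => hf_nonneg i _)
  have hrand : ∀ q : ARONSS.Policy E O → ℝ, ARONSS.IsFeasibleRandomized I q →
      ε ^ 2 * β / 2 * ARONSS.randomizedUtility D f q ≤ ARONSS.nonadaptiveUtility D f I σ := by
    intro q hq
    have hu : 0 ≤ ARONSS.randomizedUtility D f q :=
      Real.iInf_nonneg fun i => Finset.sum_nonneg fun π _ => mul_nonneg (hq.1.1 π)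
        (ARONSS.expect_nonneg hD fun y => hf_nonneg i _)
    -- The sign of `β` is not prescribed; for `β ≤ 0` nonnegativity of the utilities suffices.
    rcases le_or_gt β 0 with hβ | hβ
    · refine le_trans (mul_nonpos_of_nonpos_of_nonneg ?_ hu) hσ0
      have := mul_nonpos_of_nonneg_of_nonpos (sq_nonneg ε) hβ
      linarith
    · have h1 := mul_le_mul_of_nonneg_left
        (ARONSS.randomizedUtility_le_simulation hm hD hε₀ hf_mono hf_near hq) hβ.le
      have h2 := hσ.2 _ (ARONSS.isNonadaptive_simulation hD hq)
      linarith
  -- Weights summing to 1 force `I` to be nonempty; the policy that stops at once is then feasible.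
  have hI0 : ∅ ∈ I := by
    obtain ⟨S, hS⟩ : I.Nonempty := by
      rw [Finset.nonempty_iff_ne_empty]
      rintro rfl
      simpa using hσ.1.1
    exact hI S hS ∅ (Finset.empty_subset S)
  refine ⟨ARONSS.Policy.exists_isOptimal D f hI0, fun π hπ => ?_, hrand⟩
  have h := hrand _ hπ.1.isFeasibleRandomized_single
  rwa [ARONSS.randomizedUtility_single] at h
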